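/- Let $k$ be a field and let $G=\operatorname{Spec}A$ be an affine $k$-group ($A$ a commutative Hopf algebra over $k$) that is linearly semisimple, i.e. every linear representation of $G$ is completely reducible. Let $A^*=\operatorname{Hom}_k(A,k)$ with the algebra structure dual to the comultiplication, let $a\mapsto a^*$ be the antipode of $A$ and $w\mapsto w^*$ its transpose on $A^*$. Let $\hat G$ be the set of isomorphism classes of irreducible linear representations $\rho_i\colon G\to \operatorname{GL}(E_i)$ of $G$, let $A_i^*\subseteq \operatorname{End}_k(E_i)$ be the image of $A^*$, and write $w_i\in A_i^*$ for the image of $w\in A^*$. Let $\tilde A=\{w\in A^*: w_i=0 \text{ for all but finitely many } i\}$, and define $$\int_{\hat G}w=\operatorname{tr}(w):=\sum_{i\in\hat G}\operatorname{tr}_{A_i^*}(w_i)\quad(w\in\tilde A),$$ where $\operatorname{tr}_{A_i^*}(b)$ is the trace of the endomorphism $b'\mapsto bb'$ of $A_i^*$. Then: 1. Every $E_i$ is finite-dimensional, $w\mapsto (w_i)_i$ is an isomorphism of algebras $A^*\to\prod_{i\in\hat G}A_i^*$ (so that $\tilde A=\bigoplus_i A_i^*$), and $A_i^*=\operatorname{End}_k(E_i)$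 for all $i$ if $k$ is algebraically closed. There is a unique invariant integral on $G$, i.e. a unique $w_G\in A^*$ with $w_G(1)=1$ and $w\cdot w_G=w(1)\,w_G=w_G\cdot w$ for all $w\in A^*$. 2. The Fourier transforms $$F_G\colon A\to\tilde A,\quad F_G(a)(b)=w_G(a^*b)\quad(a,b\in A),$$ $$F_{\hat G}\colon\tilde A\to A,\quad w'(F_{\hat G}(w))=\int_{\hat G}w^*\cdot w'\quad(w\in\tilde A,\ w'\in A^*)$$ are well-defined linear maps, and $F_{\hat G}\circ F_G=*$, the antipode of $A$. 3. (Inversion formula) For all $a\in A$ and $w\in A^*$ one has $F_G(a)\cdot w\in\tilde A$ and $w(a)=\int_{\hat G}F_G(a)\cdot w$. If $k$ is algebraically closed, then for every commutative $k$-algebra $B$, every point $g\in G(B)$ and every $a\in A$, $$a(g)=\int_{\hat G}F_G(a)_i\cdot\rho_i(g)\,d\rho_i=\sum_{i\in\hat G}\dim_k(E_i)\,\operatorname{Tr}_{B\otimes_k E_i}\bigl(F_G(a)_i\cdot\rho_i(g)\bigr),$$ a sum with finitely many non-zero terms. -/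

import Mathlib

open scoped TensorProduct

universe u v w

noncomputable section

namespace AffineGroup

/-! An affine `k`-group `G = Spec A` is given by its commutative Hopf algebra `A`.
A linear representation of `G` on `E` is a right `A`-comodule structure `ρ : E → E ⊗ A`:
if `ρ e = ∑ e_l ⊗ a_l`, then a point `g` of `G` acts by `g • e = ∑ a_l(g) e_l`. -/

section Representations

variable {k : Type u} [Field k] {A : Type v} [CommRing A] [HopfAlgebra k A]

/-- `ρ` is coassociative and counital. -/
structure IsCoaction {E : Type*} [AddCommGroup E] [Module k E] (ρ : E →ₗ[k] E ⊗[k] A) : Prop where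
  coassoc : (TensorProduct.assoc k E A A).toLinearMap ∘ₗ ρ.rTensor A ∘ₗ ρ =
    (Coalgebra.comul (R := k) (A := A)).lTensor E ∘ₗ ρ
  counit : (TensorProduct.rid k E).toLinearMap ∘ₗ
    (Coalgebra.counit (R := k) (A := A)).lTensor E ∘ₗ ρ = LinearMap.id

/-- `V` is a subrepresentation: `ρ V ⊆ V ⊗ A` (inside `E ⊗ A`). -/
def IsSubrep {E : Type*} [AddCommGroup E] [Module k E] (ρ : E →ₗ[k] E ⊗[k] A)
    (V : Submodule k E) : Prop :=
  ∀ x ∈ V, ρ x ∈ LinearMap.range (V.subtype.rTensor A)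

end Representations

section

variable (k : Type u) [Field k] (A : Type v) [CommRing A] [HopfAlgebra k A]

/-- `Spec A` is (linearly) semisimple: every linear representation is completely reducible,
i.e. every subrepresentation has a complementary subrepresentation. -/
def IsLinearlySemisimple : Prop :=
  ∀ (E : Type v) [AddCommGroup E] [Module k E] (ρ : E →ₗ[k] E ⊗[k] A), IsCoaction ρ →
    ∀ V : Submodule k E, IsSubrep ρ V → ∃ W : Submodule k E, IsSubrep ρ W ∧ IsCompl V W

/-- An irreducible linear representation of `Spec A`. -/
structure IrrRep where
  /-- the underlying vector space -/
  E : Type v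
  [grp : AddCommGroup E]
  [mod : Module k E]
  /-- the coaction -/
  ρ : E →ₗ[k] E ⊗[k] A
  isCoaction : IsCoaction ρ
  nontrivial : Nontrivial E
  eq_bot_or_eq_top : ∀ V : Submodule k E, IsSubrep ρ V → V = ⊥ ∨ V = ⊤

attribute [instance] IrrRep.grp IrrRep.mod

/-- Isomorphism of irreducible representations. -/
instance IrrRep.setoid : Setoid (IrrRep k A) where
  r X Y := ∃ f : X.E ≃ₗ[k] Y.E, Y.ρ ∘ₗ f.toLinearMap = f.toLinearMap.rTensor A ∘ₗ X.ρ
  iseqv :=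
    { refl := fun X => ⟨LinearEquiv.refl k X.E, by
        ext x; simp⟩
      symm := by
        rintro X Y ⟨f, hf⟩
        refine ⟨f.symm, ?_⟩
        ext y
        have h := LinearMap.congr_fun hf (f.symm y)
        simp only [LinearMap.comp_apply, LinearEquiv.coe_coe, LinearEquiv.apply_symm_apply] at h ⊢
        rw [h, ← LinearMap.comp_apply, ← LinearMap.rTensor_comp]
        simp
      trans := by
        rintro X Y Z ⟨f, hf⟩ ⟨g, hg⟩
        refine ⟨f.trans g, ?_⟩
        ext x
        have h := LinearMap.congr_fun hf x
        have h' := LinearMap.congr_fun hg (f x)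
        simp only [LinearMap.comp_apply, LinearEquiv.coe_coe,
          LinearEquiv.coe_trans, LinearMap.rTensor_comp] at h h' ⊢
        rw [h', h] }

/-- `Ĝ`: the set of isomorphism classes of irreducible linear representations of `Spec A`. -/
def IrrClass : Type (max u (v + 1)) := Quotient (IrrRep.setoid k A)

/-- The algebra `A^*` of linear forms on `A`, with the product
`(χ * ψ)(a) = ∑ χ(a₁) ψ(a₂)` dual to the comultiplication; its unit is the counit of `A`. -/
abbrev DualAlg : Type (max u v) := WithConv (A →ₗ[k] k)

end

variable {k : Type u} [Field k] {A : Type v} [CommRing A] [HopfAlgebra k A]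

/-- A chosen representation `ρ_i : G → End(E_i)` in the class `i ∈ Ĝ`. -/
def IrrClass.rep (i : IrrClass k A) : IrrRep k A := Quotient.out i

/-- The action of `χ ∈ A^*` on a comodule: `χ • e = ∑ χ(a_l) e_l` if `ρ e = ∑ e_l ⊗ a_l`. -/
def actLin {E : Type*} [AddCommGroup E] [Module k E] (ρ : E →ₗ[k] E ⊗[k] A)
    (χ : A →ₗ[k] k) : E →ₗ[k] E :=
  (TensorProduct.rid k E).toLinearMap ∘ₗ χ.lTensor E ∘ₗ ρ

theorem actLin_one {E : Type*} [AddCommGroup E] [Module k E] {ρ : E →ₗ[k] E ⊗[k] A}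
    (h : IsCoaction ρ) : actLin ρ (1 : DualAlg k A).ofConv = 1 :=
  h.counit

theorem actLin_mul {E : Type*} [AddCommGroup E] [Module k E] {ρ : E →ₗ[k] E ⊗[k] A}
    (h : IsCoaction ρ) (χ ψ : DualAlg k A) :
    actLin ρ (χ * ψ).ofConv = actLin ρ χ.ofConv * actLin ρ ψ.ofConv := by
  have key : ∀ t : E ⊗[k] A,
      TensorProduct.rid k E ((LinearMap.mul' k k ∘ₗ TensorProduct.map χ.ofConv ψ.ofConv).lTensor E
        (TensorProduct.assoc k E A A (ρ.rTensor A t))) =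
      actLin ρ χ.ofConv (TensorProduct.rid k E (ψ.ofConv.lTensor E t)) := by
    intro t
    induction t with
    | zero => simp
    | add s t hs ht => simp only [map_add, hs, ht]
    | tmul e a =>
      simp only [LinearMap.rTensor_tmul, LinearMap.lTensor_tmul, TensorProduct.rid_tmul, map_smul]
      simp only [actLin, LinearMap.comp_apply, LinearEquiv.coe_coe]
      induction ρ e with
      | zero => simp
      | add s t hs ht => simp only [map_add, hs, ht, TensorProduct.add_tmul, smul_add]
      | tmul f b => simp [smul_smul, mul_comm]
  ext e
  have hc := LinearMap.congr_fun h.coassoc e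
  simp only [LinearMap.comp_apply, LinearEquiv.coe_coe] at hc
  have hk := key (ρ e)
  rw [hc, ← LinearMap.comp_apply, ← LinearMap.lTensor_comp] at hk
  exact hk

/-- `A^* → End(E)`, the algebra morphism defined by a linear representation `E`. -/
def act {E : Type*} [AddCommGroup E] [Module k E] {ρ : E →ₗ[k] E ⊗[k] A}
    (h : IsCoaction ρ) : DualAlg k A →ₐ[k] Module.End k E :=
  AlgHom.ofLinearMap
    { toFun := fun χ => actLin ρ χ.ofConv
      map_add' := fun χ ψ => by
        ext x; simp [actLin, LinearMap.lTensor_add]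
      map_smul' := fun c χ => by
        ext x; simp [actLin, LinearMap.lTensor_smul] }
    (actLin_one h) (actLin_mul h)

/-- The morphism `A^* → End(E_i)` for `i ∈ Ĝ`. -/
def actIrr (i : IrrClass k A) : DualAlg k A →ₐ[k] Module.End k i.rep.E :=
  act i.rep.isCoaction

/-- The algebra `A_i^* ⊆ End(E_i)`, the image of `A^*`. -/
abbrev block (i : IrrClass k A) : Subalgebra k (Module.End k i.rep.E) := (actIrr i).range

/-- The component `χ_i ∈ A_i^*` of `χ ∈ A^*`. -/
def component (i : IrrClass k A) : DualAlg k A →ₐ[k] block i := (actIrr i).rangeRestrict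

/-- `tr_{A_i^*}(b)`, the trace of the endomorphism `b' ↦ b b'` of `A_i^*`. -/
def blockTrace (i : IrrClass k A) : block i →ₗ[k] k :=
  LinearMap.trace k (block i) ∘ₗ LinearMap.mul k (block i)

variable (k A) in
/-- `Ã = ⊕_i A_i^*`: the elements of `A^*` with finitely many non-zero components,
the algebra of functions of `Ĝ`. -/
def tildeA : Submodule k (DualAlg k A) where
  carrier := {χ | {i : IrrClass k A | component i χ ≠ 0}.Finite}
  zero_mem' := by simp
  add_mem' := fun {χ ψ} hχ hψ => (hχ.union hψ).subset fun i hi => by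
    by_contra h
    simp only [Set.mem_union, Set.mem_ofPred_eq, not_or, not_not] at h
    exact hi (by rw [map_add, h.1, h.2, add_zero])
  smul_mem' := fun c χ hχ => Set.Finite.subset hχ fun i hi h => hi (by rw [map_smul, h, smul_zero])

theorem finite_trace_support (χ : tildeA k A) :
    (Function.support fun i : IrrClass k A =>
      blockTrace i (component i (χ : DualAlg k A))).Finite :=
  Set.Finite.subset χ.2 fun i hi h => hi (by
    show blockTrace i (component i (χ : DualAlg k A)) = 0
    rw [h, map_zero])

variable (k A) in
/-- `tr = ∫_Ĝ : Ã → k`, the sum over `i ∈ Ĝ` of the traces `tr_{A_i^*}`. -/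
def trHat : tildeA k A →ₗ[k] k where
  toFun χ := ∑ᶠ i : IrrClass k A, blockTrace i (component i (χ : DualAlg k A))
  map_add' χ ψ := by
    rw [← finsum_add_distrib (finite_trace_support χ) (finite_trace_support ψ)]
    simp
  map_smul' c χ := by
    rw [RingHom.id_apply, smul_finsum]
    simp

/-- `w` is an invariant integral on `Spec A`: normalized by `w(1) = 1` and invariant under
left and right multiplication by `G`, equivalently by `A^*`. -/
structure IsInvariantIntegral (w : DualAlg k A) : Prop where
  normalized : w.ofConv 1 = 1
  left_invariant : ∀ χ : DualAlg k A, χ * w = χ.ofConv 1 • w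
  right_invariant : ∀ χ : DualAlg k A, w * χ = χ.ofConv 1 • w

/-- `a ↦ w(a^* · -)`, where `a^*` is the antipode applied to `a`; the Fourier transform of `G`
when `w` is the invariant integral. -/
def fourier (w : DualAlg k A) : A →ₗ[k] DualAlg k A where
  toFun a := WithConv.toConv (w.ofConv ∘ₗ LinearMap.mulLeft k (HopfAlgebra.antipode k a))
  map_add' a b := by ext; simp [add_mul]
  map_smul' c a := by ext; simp

/-- `χ ↦ χ^*`, the transpose `A^* → A^*` of the antipode. -/
def dualStar (χ : DualAlg k A) : DualAlg k A :=
  WithConv.toConv (χ.ofConv ∘ₗ HopfAlgebra.antipode k)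

/-- The action `ρ_i(g)` of a `B`-valued point `g` of `Spec A` on `B ⊗ E_i`: the `B`-linear map with
`1 ⊗ e ↦ ∑ g(a_l) ⊗ e_l` if `ρ e = ∑ e_l ⊗ a_l`. -/
def pointAct (i : IrrClass k A) {B : Type*} [CommRing B] [Algebra k B] (g : A →ₐ[k] B) :
    Module.End B (B ⊗[k] i.rep.E) :=
  LinearMap.liftBaseChange B
    ((TensorProduct.comm k i.rep.E B).toLinearMap ∘ₗ g.toLinearMap.lTensor i.rep.E ∘ₗ i.rep.ρ)

end AffineGroup

end

open AffineGroup

/-! Linear forms separate the elements of `M ⊗ A`, so subrepresentations are exactly the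
`A^*`-stable subspaces. Complete reducibility of the regular representation splits `A` into isotypic
components `A_i`. Matrix coefficients embed every `E_i` in `A`, so the index set is all of `Ĝ`. A
form kills `E_i` iff it vanishes on `A_i` (`actIrr_eq_zero_iff`). Hence `A_i^*` is the dual of
`A_i`, and `A^*` is their product.

The invariant integral `h` is the projection of `A` onto the constants along an invariant
complement. Everything about the Fourier transform `F` rests on `translate_fourier`: left
multiplication by `F(a)` on `A^*` is the transpose of `y ↦ ∑ h(S(a₂) y) a₁`. For `a ∈ A_i` this
operator has image in `A_i`, so `F(a)` lives in the single block `i`. It is a sum of rank-one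
operators, and the trace of its composite with translation by `χ` is `h(∑ χ(a₁) a₂ S(a₃)) = χ(a)`,
which is the inversion formula.

Inversion makes `F` injective, and equality of dimensions on each block makes it bijective. The
transform of `Ĝ` is then `S ∘ F⁻¹`. -/

noncomputable section

namespace AffineGroup

/-! ### Representations as modules over `A^*` -/

section Comodules

variable {k : Type u} [Field k] {A : Type v} [CommRing A] [HopfAlgebra k A]

/-- The contraction `M ⊗ A → M` of the second factor by a linear form on `A`. -/
def contr (M : Type*) [AddCommGroup M] [Module k M] (χ : A →ₗ[k] k) : M ⊗[k] A →ₗ[k] M :=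
  (TensorProduct.rid k M).toLinearMap ∘ₗ χ.lTensor M

@[simp]
theorem contr_tmul {M : Type*} [AddCommGroup M] [Module k M] (χ : A →ₗ[k] k) (m : M) (a : A) :
    contr M χ (m ⊗ₜ[k] a) = χ a • m := by
  simp [contr]

theorem actLin_apply {E : Type*} [AddCommGroup E] [Module k E] (ρ : E →ₗ[k] E ⊗[k] A)
    (χ : A →ₗ[k] k) (e : E) : actLin ρ χ e = contr E χ (ρ e) := rfl

theorem contr_rTensor {M N : Type*} [AddCommGroup M] [Module k M] [AddCommGroup N] [Module k N]
    (f : M →ₗ[k] N) (χ : A →ₗ[k] k) (t : M ⊗[k] A) :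
    contr N χ (f.rTensor A t) = f (contr M χ t) := by
  induction t with
  | zero => simp
  | add s t hs ht => simp only [map_add, hs, ht]
  | tmul m a => simp

theorem apply_lid_rTensor {M : Type*} [AddCommGroup M] [Module k M]
    (f : M →ₗ[k] k) (χ : A →ₗ[k] k) (t : M ⊗[k] A) :
    χ (TensorProduct.lid k A (f.rTensor A t)) = f (contr M χ t) := by
  induction t with
  | zero => simp
  | add s t hs ht => simp only [map_add, hs, ht]
  | tmul m a => simp [mul_comm]

/-- Linear forms on `A` separate the elements of `M ⊗ A`. -/
theorem eq_zero_of_contr {M : Type*} [AddCommGroup M] [Module k M] (t : M ⊗[k] A)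
    (h : ∀ χ : A →ₗ[k] k, contr M χ t = 0) : t = 0 := by
  classical
  let b := Module.Free.chooseBasis k A
  apply (TensorProduct.equivFinsuppOfBasisRight (M := M) b).injective
  rw [map_zero]
  ext i
  have key : ∀ s : M ⊗[k] A, TensorProduct.equivFinsuppOfBasisRight b s i =
      contr M (b.coord i) s := by
    intro s
    induction s with
    | zero => simp
    | add s t hs ht => simp only [map_add, Finsupp.add_apply, hs, ht]
    | tmul m a => rw [TensorProduct.equivFinsuppOfBasisRight_apply_tmul_apply]; simp
  rw [key, h, Finsupp.zero_apply]

theorem eq_of_contr {M : Type*} [AddCommGroup M] [Module k M] {s t : M ⊗[k] A}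
    (h : ∀ χ : A →ₗ[k] k, contr M χ s = contr M χ t) : s = t :=
  sub_eq_zero.1 <| eq_zero_of_contr _ fun χ => by rw [map_sub, h, sub_self]

section

variable {E : Type*} [AddCommGroup E] [Module k E] {ρ : E →ₗ[k] E ⊗[k] A}

/-- A subspace is a subrepresentation if and only if it is stable under `A^*`. -/
theorem isSubrep_iff (V : Submodule k E) :
    IsSubrep ρ V ↔ ∀ χ : A →ₗ[k] k, ∀ x ∈ V, actLin ρ χ x ∈ V := by
  constructor
  · intro h χ x hx
    obtain ⟨t, ht⟩ := h x hx
    rw [actLin_apply, ← ht, contr_rTensor]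
    exact (contr V χ t).2
  · intro h x hx
    -- `V ⊗ A` is the kernel of `E ⊗ A → (E/V) ⊗ A`, where vanishing is tested by linear forms on
    -- `A`.
    have hex : Function.Exact V.subtype V.mkQ := LinearMap.exact_subtype_mkQ V
    refine (rTensor_exact A hex V.mkQ_surjective (ρ x)).1 (eq_zero_of_contr _ fun χ => ?_)
    rw [contr_rTensor, ← actLin_apply, Submodule.mkQ_apply, Submodule.Quotient.mk_eq_zero]
    exact h χ x hx

/-- A subrepresentation carries an induced coaction. -/
theorem IsSubrep.exists_coaction (h : IsCoaction ρ) {V : Submodule k E} (hV : IsSubrep ρ V) :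
    ∃ σ : V →ₗ[k] V ⊗[k] A, IsCoaction σ ∧ V.subtype.rTensor A ∘ₗ σ = ρ ∘ₗ V.subtype := by
  have hinj : ∀ (P : Type v) [AddCommGroup P] [Module k P],
      Function.Injective (V.subtype.rTensor P) := fun P _ _ =>
    Module.Flat.rTensor_preserves_injective_linearMap _ V.subtype_injective
  -- `V ⊗ A` embeds in `E ⊗ A` by flatness, so `ρ` pulls back to `V`; coassociativity is then
  -- checked after the inclusion.
  let σ : V →ₗ[k] V ⊗[k] A := (LinearEquiv.ofInjective _ (hinj A)).symm.toLinearMap ∘ₗ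
    (ρ ∘ₗ V.subtype).codRestrict _ fun x => hV x x.2
  have hσ : ∀ x, V.subtype.rTensor A (σ x) = ρ x := fun x => by
    have := (LinearEquiv.ofInjective _ (hinj A)).apply_symm_apply
      ((ρ ∘ₗ V.subtype).codRestrict _ (fun x => hV x x.2) x)
    exact congrArg Subtype.val this
  refine ⟨σ, ⟨?_, ?_⟩, LinearMap.ext hσ⟩
  · ext x
    apply hinj (A ⊗[k] A)
    have e1 : ∀ t : V ⊗[k] A, V.subtype.rTensor (A ⊗[k] A)
        (TensorProduct.assoc k V A A (σ.rTensor A t)) =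
        TensorProduct.assoc k E A A (ρ.rTensor A (V.subtype.rTensor A t)) := by
      intro t
      induction t with
      | zero => simp
      | add s t hs ht => simp only [map_add, hs, ht]
      | tmul m a =>
        simp only [LinearMap.rTensor_tmul, Submodule.subtype_apply, ← hσ]
        induction σ m with
        | zero => simp
        | add s t hs ht => simp only [map_add, TensorProduct.add_tmul, hs, ht]
        | tmul m a => simp
    have e2 : ∀ t : V ⊗[k] A, V.subtype.rTensor (A ⊗[k] A)
        ((Coalgebra.comul (R := k) (A := A)).lTensor V t) =
        (Coalgebra.comul (R := k) (A := A)).lTensor E (V.subtype.rTensor A t) := by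
      intro t
      simp only [← LinearMap.comp_apply, LinearMap.rTensor_comp_lTensor,
        LinearMap.lTensor_comp_rTensor]
    simp only [LinearMap.comp_apply, LinearEquiv.coe_coe]
    rw [e1, e2, hσ]
    exact LinearMap.congr_fun h.coassoc x
  · ext x
    have := LinearMap.congr_fun h.counit x
    change ((contr V _ (σ x) : V) : E) = x
    rw [← Submodule.subtype_apply, ← contr_rTensor, hσ]
    exact this

/-- Representations are locally finite: the orbit of a vector under `A^*` spans a
finite-dimensional space. -/
theorem exists_finite_span_actLin (e : E) :
    ∃ V : Submodule k E, V.FG ∧ ∀ χ : A →ₗ[k] k, actLin ρ χ e ∈ V := by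
  classical
  obtain ⟨s, hs⟩ := TensorProduct.exists_finset (ρ e)
  refine ⟨Submodule.span k (s.image Prod.fst), ⟨_, rfl⟩, fun χ => ?_⟩
  rw [actLin_apply, hs, map_sum]
  refine Submodule.sum_mem _ fun i hi => ?_
  rw [contr_tmul]
  exact Submodule.smul_mem _ _ (Submodule.subset_span (by
    rw [Finset.mem_coe]; exact Finset.mem_image_of_mem _ hi))

/-- The matrix coefficients `∑ f(e_l) a_l` of a representation, as a function of `e`. -/
def coeff (ρ : E →ₗ[k] E ⊗[k] A) (f : E →ₗ[k] k) : E →ₗ[k] A :=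
  (TensorProduct.lid k A).toLinearMap ∘ₗ f.rTensor A ∘ₗ ρ

theorem apply_coeff (f : E →ₗ[k] k) (χ : A →ₗ[k] k) (e : E) :
    χ (coeff ρ f e) = f (actLin ρ χ e) :=
  apply_lid_rTensor f χ (ρ e)

end

variable (k A) in
theorem isCoaction_comul : IsCoaction (Coalgebra.comul (R := k) (A := A)) where
  coassoc := Coalgebra.coassoc
  counit := by
    rw [Coalgebra.lTensor_counit_comp_comul]
    ext; simp

/-- `A^*` acts on an irreducible representation. -/
instance IrrRep.moduleDualAlg (X : IrrRep k A) : Module (DualAlg k A) X.E :=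
  Module.compHom X.E (act X.isCoaction).toRingHom

instance IrrRep.isScalarTower (X : IrrRep k A) : IsScalarTower k (DualAlg k A) X.E where
  smul_assoc c χ e := LinearMap.congr_fun (map_smul (act X.isCoaction) c χ) e

/-- `A^*` acts on `A`, by the regular representation. -/
instance regularModule : Module (DualAlg k A) A :=
  Module.compHom A (act (isCoaction_comul k A)).toRingHom

theorem regular_smul_def (χ : DualAlg k A) (a : A) :
    χ • a = actLin (Coalgebra.comul (R := k)) χ.ofConv a := rfl

instance : IsScalarTower k (DualAlg k A) A where
  smul_assoc c χ e := LinearMap.congr_fun (map_smul (act (isCoaction_comul k A)) c χ) e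

instance IrrRep.isSimpleModule (X : IrrRep k A) : IsSimpleModule (DualAlg k A) X.E := by
  have := X.nontrivial
  rw [isSimpleModule_iff]
  have : Nontrivial (Submodule (DualAlg k A) X.E) := inferInstance
  refine ⟨fun N => ?_⟩
  have h := X.eq_bot_or_eq_top (N.restrictScalars k) ((isSubrep_iff _).2 fun χ x hx =>
    N.smul_mem (WithConv.toConv χ) hx)
  rcases h with h | h
  · exact Or.inl ((Submodule.restrictScalars_eq_bot_iff k _ _).1 h)
  · exact Or.inr ((Submodule.restrictScalars_eq_top_iff k _ _).1 h)

/-- Any nonzero vector generates a simple module, and its orbit lies in a finite-dimensional space.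
-/
instance IrrRep.finite (X : IrrRep k A) : Module.Finite k X.E := by
  have := X.nontrivial
  obtain ⟨e, he⟩ := exists_ne (0 : X.E)
  obtain ⟨V, hV, h⟩ := exists_finite_span_actLin (ρ := X.ρ) e
  refine ⟨?_⟩
  convert hV
  refine (eq_top_iff.2 fun x _ => ?_).symm
  obtain ⟨χ, rfl⟩ := IsSimpleModule.toSpanSingleton_surjective (DualAlg k A) he x
  exact h χ.ofConv

theorem IrrRep.equiv_of_linearEquiv {X Y : IrrRep k A} (f : X.E ≃ₗ[DualAlg k A] Y.E) : X ≈ Y := by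
  refine ⟨f.restrictScalars k, LinearMap.ext fun x => eq_of_contr fun χ => ?_⟩
  have := f.map_smul (WithConv.toConv χ) x
  rw [LinearMap.comp_apply, LinearMap.comp_apply, contr_rTensor]
  exact this.symm

theorem IrrRep.linearEquiv_of_equiv {X Y : IrrRep k A} (h : X ≈ Y) :
    Nonempty (X.E ≃ₗ[DualAlg k A] Y.E) := by
  obtain ⟨f, hf⟩ := h
  refine ⟨{ f with map_smul' := fun χ x => ?_ }⟩
  have := congrArg (contr Y.E χ.ofConv) (LinearMap.congr_fun hf x)
  rw [LinearMap.comp_apply, LinearMap.comp_apply, contr_rTensor] at this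
  exact this.symm

theorem IsLinearlySemisimple.isSemisimpleModule (hG : IsLinearlySemisimple k A) :
    IsSemisimpleModule (DualAlg k A) A := by
  refine (isSemisimpleModule_iff _ _).2 ⟨fun N => ?_⟩
  obtain ⟨W, hW, hc⟩ := hG A _ (isCoaction_comul k A) (N.restrictScalars k)
    ((isSubrep_iff _).2 fun χ x hx => N.smul_mem (WithConv.toConv χ) hx)
  rw [isSubrep_iff] at hW
  let W' : Submodule (DualAlg k A) A :=
    { W with smul_mem' := fun χ x hx => hW χ.ofConv x hx }
  have hW' : W'.restrictScalars k = W := rfl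
  refine ⟨W', ?_⟩
  rw [← hW', isCompl_iff, disjoint_iff, codisjoint_iff, ← Submodule.restrictScalars_inf,
    ← Submodule.restrictScalars_sup] at hc
  rw [isCompl_iff, disjoint_iff, codisjoint_iff]
  exact ⟨(Submodule.restrictScalars_eq_bot_iff k _ _).1 hc.1,
    (Submodule.restrictScalars_eq_top_iff k _ _).1 hc.2⟩

/-- Every simple submodule of the regular representation is isomorphic to some `E_i`. -/
theorem exists_linearEquiv_rep (N : Submodule (DualAlg k A) A) [IsSimpleModule (DualAlg k A) N] :
    ∃ i : IrrClass k A, Nonempty (N ≃ₗ[DualAlg k A] i.rep.E) := by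
  obtain ⟨σ, hσ, hsub⟩ := IsSubrep.exists_coaction (isCoaction_comul k A)
    (V := N.restrictScalars k)
    ((isSubrep_iff _).2 fun χ x hx => N.smul_mem (WithConv.toConv χ) hx)
  have hact : ∀ χ x, ((actLin σ χ x : N.restrictScalars k) : A) =
      actLin (Coalgebra.comul (R := k)) χ (x : A) := fun χ x => by
    rw [actLin_apply, ← Submodule.subtype_apply, ← contr_rTensor]
    exact congrArg (contr A χ) (LinearMap.congr_fun hsub x)
  let X : IrrRep k A :=
    { E := N.restrictScalars k
      ρ := σ
      isCoaction := hσ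
      nontrivial := IsSimpleModule.nontrivial (DualAlg k A) N
      eq_bot_or_eq_top := fun V hV => by
        rw [isSubrep_iff] at hV
        let V' : Submodule (DualAlg k A) N :=
          { V with
            smul_mem' := fun χ x hx => by
              have h : χ • x = actLin σ χ.ofConv x := Subtype.ext (hact _ _).symm
              rw [h]
              exact hV χ.ofConv x hx }
        have := (isSimpleModule_iff (DualAlg k A) N).1 inferInstance
        rcases eq_bot_or_eq_top V' with h | h
        · left
          refine (Submodule.eq_bot_iff _).2 fun x hx => ?_
          exact (Submodule.eq_bot_iff _).1 h x hx
        · right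
          refine Submodule.eq_top_iff'.2 fun x => ?_
          exact Submodule.eq_top_iff'.1 h x }
  -- The representative chosen in the class of `N` is only isomorphic to `N`, which accounts for the
  -- second isomorphism `f`.
  obtain ⟨Y, g, hg⟩ : ∃ (Y : IrrRep k A) (g : N ≃ₗ[k] Y.E),
      ∀ (χ : DualAlg k A) x, g (χ • x) = actLin Y.ρ χ.ofConv (g x) :=
    ⟨X, LinearEquiv.refl k N, fun χ x => Subtype.ext (hact χ.ofConv x).symm⟩
  obtain ⟨f⟩ := IrrRep.linearEquiv_of_equiv
    (Setoid.symm (Quotient.mk_out Y : IrrClass.rep (Quotient.mk _ Y) ≈ Y))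
  exact ⟨Quotient.mk _ Y, ⟨LinearEquiv.trans { g with map_smul' := hg } f⟩⟩

theorem IrrClass.eq_of_linearEquiv {i j : IrrClass k A}
    (f : i.rep.E ≃ₗ[DualAlg k A] j.rep.E) : i = j := by
  rw [← Quotient.out_eq i, ← Quotient.out_eq j]
  exact Quotient.sound (IrrRep.equiv_of_linearEquiv f)

end Comodules

/-! ### Peter–Weyl decomposition of `A` and of `A^*` -/

section PeterWeyl

variable {k : Type u} [Field k] {A : Type v} [CommRing A] [HopfAlgebra k A]

theorem counit_smul (χ : DualAlg k A) (a : A) :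
    Coalgebra.counit (R := k) (χ • a) = χ.ofConv a := by
  rw [regular_smul_def, actLin_apply, ← apply_lid_rTensor, Coalgebra.rTensor_counit_comul]
  simp

/-- The regular action is the transpose of right multiplication in `A^*`, since the counit recovers
a form from its action. -/
theorem apply_smul (χ ψ : DualAlg k A) (a : A) : ψ.ofConv (χ • a) = (ψ * χ).ofConv a := by
  rw [← counit_smul ψ, ← mul_smul, counit_smul]

theorem dual_ext {a b : A} (h : ∀ χ : DualAlg k A, χ.ofConv a = χ.ofConv b) : a = b := by
  rw [← sub_eq_zero, ← Module.forall_dual_apply_eq_zero_iff k]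
  intro φ
  have := h (WithConv.toConv φ)
  rw [map_sub, sub_eq_zero]
  exact this

theorem coeff_actLin {E : Type*} [AddCommGroup E] [Module k E] {ρ : E →ₗ[k] E ⊗[k] A}
    (h : IsCoaction ρ) (f : E →ₗ[k] k) (χ : DualAlg k A) (e : E) :
    coeff ρ f (actLin ρ χ.ofConv e) = χ • coeff ρ f e := by
  refine dual_ext (k := k) fun ψ => ?_
  rw [apply_coeff, apply_smul, apply_coeff, actLin_mul h]
  rfl

/-- The matrix coefficients of `E_i`: the isotypic component of the regular representation. -/
def isotypic (i : IrrClass k A) : Submodule k A :=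
  (isotypicComponent (DualAlg k A) A i.rep.E).restrictScalars k

theorem smul_mem_isotypic {i : IrrClass k A} (χ : DualAlg k A) {a : A} (ha : a ∈ isotypic i) :
    χ • a ∈ isotypic i :=
  (isotypicComponent (DualAlg k A) A i.rep.E).smul_mem χ ha

/-- `coeff` as a morphism of representations `E_i → A`. -/
def coeffHom (i : IrrClass k A) (f : i.rep.E →ₗ[k] k) : i.rep.E →ₗ[DualAlg k A] A where
  toFun := coeff i.rep.ρ f
  map_add' := map_add _
  map_smul' χ e := coeff_actLin i.rep.isCoaction f χ e

theorem coeff_mem_isotypic (i : IrrClass k A) (f : i.rep.E →ₗ[k] k) (e : i.rep.E) :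
    coeff i.rep.ρ f e ∈ isotypic i := by
  have h : (⊤ : Submodule (DualAlg k A) i.rep.E) ≤
      isotypicComponent (DualAlg k A) i.rep.E i.rep.E := le_sSup ⟨Submodule.topEquiv⟩
  exact LinearMap.le_comap_isotypicComponent i.rep.E (coeffHom i f) (h (Submodule.mem_top (x := e)))

/-- `A_i` is a sum of copies of `E_i`, so a form killing `E_i` kills `A_i`, and the counit turns
this into vanishing of its values. Conversely `A_i` contains the coefficients on which `χ` takes the
values `f(χ • e)`. -/
theorem actIrr_eq_zero_iff (i : IrrClass k A) (χ : DualAlg k A) :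
    actIrr i χ = 0 ↔ ∀ a ∈ isotypic i, χ.ofConv a = 0 := by
  constructor
  · intro h a ha
    have key : ∀ a ∈ isotypicComponent (DualAlg k A) A i.rep.E, χ • a = 0 := by
      intro a ha
      rw [isotypicComponent, sSup_eq_iSup'] at ha
      refine Submodule.iSup_induction _ (motive := fun a => χ • a = 0) ha ?_ (smul_zero χ) ?_
      · rintro ⟨N, ⟨f⟩⟩ x hx
        have : f (χ • ⟨x, hx⟩) = 0 := by
          rw [map_smul]
          exact LinearMap.congr_fun h _
        rw [LinearEquiv.map_eq_zero_iff] at this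
        exact congrArg Subtype.val this
      · intro x y hx hy
        rw [smul_add, hx, hy, add_zero]
    rw [← counit_smul, key a ha, map_zero]
  · intro h
    ext e
    refine (Module.forall_dual_apply_eq_zero_iff k _).1 fun f => ?_
    have := h _ (coeff_mem_isotypic i f e)
    rwa [apply_coeff] at this

theorem component_eq_zero_iff (i : IrrClass k A) (χ : DualAlg k A) :
    component i χ = 0 ↔ ∀ a ∈ isotypic i, χ.ofConv a = 0 := by
  rw [← actIrr_eq_zero_iff, ← Subtype.coe_inj]
  rfl

theorem iSup_isotypic (hG : IsLinearlySemisimple k A) :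
    ⨆ i : IrrClass k A, isotypicComponent (DualAlg k A) A i.rep.E = ⊤ := by
  have := hG.isSemisimpleModule
  rw [eq_top_iff, ← IsSemisimpleModule.sSup_simples_eq_top]
  refine sSup_le fun N hN => ?_
  have : IsSimpleModule (DualAlg k A) N := hN
  obtain ⟨i, hi⟩ := exists_linearEquiv_rep N
  exact le_iSup_of_le i (le_sSup hi)

/-- The counit of the coefficient of `e` along `f` is `f(e)`. Choosing `f(e) ≠ 0` gives a nonzero
morphism out of a simple module. -/
theorem exists_embedding (i : IrrClass k A) :
    ∃ g : i.rep.E →ₗ[DualAlg k A] A, Function.Injective g := by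
  have := i.rep.nontrivial
  obtain ⟨e, he⟩ := exists_ne (0 : i.rep.E)
  obtain ⟨f, hf⟩ : ∃ f : i.rep.E →ₗ[k] k, f e ≠ 0 := by
    by_contra! h
    exact he ((Module.forall_dual_apply_eq_zero_iff k e).1 h)
  refine ⟨coeffHom i f, (LinearMap.injective_or_eq_zero (R := DualAlg k A)
    (coeffHom i f)).resolve_right fun h0 => hf ?_⟩
  have h1 : coeff i.rep.ρ f e = 0 := LinearMap.congr_fun h0 e
  have h2 := apply_coeff (ρ := i.rep.ρ) f (1 : DualAlg k A).ofConv e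
  rw [h1, map_zero, actLin_one i.rep.isCoaction] at h2
  exact h2.symm

/-- A copy of `E_i` inside the component of `E_j` must be isomorphic to `E_j`. -/
theorem isotypicComponent_rep_injective :
    Function.Injective fun i : IrrClass k A => isotypicComponent (DualAlg k A) A i.rep.E := by
  intro i j (hij : isotypicComponent (DualAlg k A) A i.rep.E = _)
  obtain ⟨f, hf⟩ := exists_embedding i
  let φ := LinearEquiv.ofInjective f hf
  have hle : LinearMap.range f ≤ isotypicComponent (DualAlg k A) A j.rep.E := by
    change _ = isotypicComponent (DualAlg k A) A j.rep.E at hij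
    rw [← hij]
    exact le_sSup ⟨φ.symm⟩
  have : IsSimpleModule (DualAlg k A) (LinearMap.range f) :=
    IsSimpleModule.congr (R := DualAlg k A) φ.symm
  obtain ⟨ψ⟩ := (isIsotypicOfType_submodule_iff (R := DualAlg k A)).1
    (IsIsotypicOfType.isotypicComponent (DualAlg k A) A j.rep.E) (LinearMap.range f) hle
  exact IrrClass.eq_of_linearEquiv (φ.trans ψ)

theorem iSupIndep_isotypicComponent :
    iSupIndep fun i : IrrClass k A => isotypicComponent (DualAlg k A) A i.rep.E := by
  have hmem : ∀ i : IrrClass k A, isotypicComponent (DualAlg k A) A i.rep.E ∈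
      isotypicComponents (DualAlg k A) A := fun i => by
    obtain ⟨f, hf⟩ := exists_embedding i
    let φ := LinearEquiv.ofInjective f hf
    exact ⟨LinearMap.range f, IsSimpleModule.congr (R := DualAlg k A) φ.symm,
      φ.isotypicComponent_eq⟩
  exact ((sSupIndep_iff _).1 (sSupIndep_isotypicComponents (DualAlg k A) A)).comp
    (f := fun i : IrrClass k A => ⟨_, hmem i⟩)
    fun i j h => isotypicComponent_rep_injective (congrArg Subtype.val h)

open Classical in
theorem isInternal_isotypic (hG : IsLinearlySemisimple k A) :
    DirectSum.IsInternal (isotypic : IrrClass k A → Submodule k A) := by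
  have := DirectSum.isInternal_submodule_of_iSupIndep_of_iSup_eq_top
    (iSupIndep_isotypicComponent (k := k) (A := A)) (iSup_isotypic hG)
  exact this

theorem iSup_isotypic_eq_top (hG : IsLinearlySemisimple k A) :
    ⨆ i : IrrClass k A, isotypic i = ⊤ := by
  classical
  exact (isInternal_isotypic hG).submodule_iSup_eq_top

theorem disjoint_isotypic {i j : IrrClass k A} (h : i ≠ j) {a : A} (hi : a ∈ isotypic i)
    (hj : a ∈ isotypic j) : a = 0 :=
  (Submodule.mem_bot (DualAlg k A)).1 <| (disjoint_iff_inf_le.1 <|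
    (iSupIndep_isotypicComponent (k := k) (A := A)).pairwiseDisjoint h) ⟨hi, hj⟩

/-- Injectivity holds because the `A_i` span `A`; surjectivity because forms prescribed on the
summands of a direct sum glue. -/
theorem bijective_component (hG : IsLinearlySemisimple k A) :
    Function.Bijective fun (χ : DualAlg k A) (i : IrrClass k A) => component i χ := by
  classical
  constructor
  · intro χ ψ h
    rw [← sub_eq_zero]
    set θ : DualAlg k A := χ - ψ with hθ
    have h0 : ∀ i : IrrClass k A, component i θ = 0 := fun i => by
      rw [hθ, map_sub, sub_eq_zero]
      exact congrFun h i
    have hker : ⨆ i : IrrClass k A, isotypic i ≤ LinearMap.ker θ.ofConv :=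
      iSup_le fun i a ha => (component_eq_zero_iff i θ).1 (h0 i) a ha
    rw [iSup_isotypic_eq_top hG] at hker
    ext a
    exact hker Submodule.mem_top
  · intro b
    choose ψ hψ using fun i => (actIrr i).rangeRestrict_surjective (b i)
    let D := LinearEquiv.ofBijective (DirectSum.coeLinearMap (isotypic : IrrClass k A → _))
      (isInternal_isotypic hG)
    let χ : A →ₗ[k] k := DirectSum.toModule k _ _
      (fun i => (ψ i).ofConv ∘ₗ (isotypic i).subtype) ∘ₗ D.symm.toLinearMap
    have hχ : ∀ i, ∀ a ∈ isotypic i, χ a = (ψ i).ofConv a := by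
      intro i a ha
      have : D.symm a = DirectSum.lof k _ (fun i => isotypic i) i ⟨a, ha⟩ := by
        rw [LinearEquiv.symm_apply_eq]
        exact (DirectSum.coeLinearMap_lof (isotypic : IrrClass k A → _) i ⟨a, ha⟩).symm
      simp only [χ, LinearMap.comp_apply, LinearEquiv.coe_coe, this, DirectSum.toModule_lof]
      rfl
    refine ⟨WithConv.toConv χ, funext fun i => ?_⟩
    rw [← hψ i, ← sub_eq_zero]
    change component i _ - component i (ψ i) = 0
    rw [← map_sub, component_eq_zero_iff]
    intro a ha
    change χ a - (ψ i).ofConv a = 0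
    rw [hχ i a ha, sub_self]

/-- Restriction of linear forms identifies `A_i^*` with the dual of the isotypic component. -/
theorem exists_block_equiv_dual (i : IrrClass k A) :
    ∃ e : block i ≃ₗ[k] Module.Dual k (isotypic i),
      ∀ χ, e (component i χ) = χ.ofConv ∘ₗ (isotypic i).subtype := by
  let r : DualAlg k A →ₗ[k] Module.Dual k (isotypic i) :=
    { toFun := fun χ => χ.ofConv ∘ₗ (isotypic i).subtype
      map_add' := fun _ _ => rfl
      map_smul' := fun _ _ => rfl }
  have hr : Function.Surjective r := fun f => by
    obtain ⟨g, hg⟩ := LinearMap.exists_extend f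
    exact ⟨WithConv.toConv g, hg⟩
  let c : DualAlg k A →ₗ[k] block i := (component i).toLinearMap
  have hc : Function.Surjective c := (actIrr i).rangeRestrict_surjective
  have hker : LinearMap.ker c = LinearMap.ker r := by
    ext χ
    rw [LinearMap.mem_ker, LinearMap.mem_ker]
    refine (component_eq_zero_iff i χ).trans ⟨fun h => ?_, fun h a ha => ?_⟩
    · ext a
      exact h a a.2
    · exact LinearMap.congr_fun h ⟨a, ha⟩
  refine ⟨(c.quotKerEquivOfSurjective hc).symm ≪≫ₗ Submodule.quotEquivOfEq _ _ hker ≪≫ₗ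
    r.quotKerEquivOfSurjective hr, fun χ => ?_⟩
  have : (c.quotKerEquivOfSurjective hc).symm (component i χ) = Submodule.Quotient.mk χ := by
    rw [LinearEquiv.symm_apply_eq]
    rfl
  rw [LinearEquiv.trans_apply, LinearEquiv.trans_apply, this]
  rfl

/-- The dual is `block i`, a subspace of the endomorphisms of a finite-dimensional space. -/
instance (i : IrrClass k A) : Module.Finite k (isotypic i) := by
  obtain ⟨e, -⟩ := exists_block_equiv_dual i
  rw [← Module.finite_dual_iff k]
  exact Module.Finite.equiv e

/-- The translation `b ↦ ∑ χ(b₁) b₂`, transpose to the left multiplication by `χ` in `A^*`. -/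
def translate (χ : DualAlg k A) : A →ₗ[k] A := coeff (Coalgebra.comul (R := k)) χ.ofConv

theorem apply_translate (χ ψ : DualAlg k A) (a : A) :
    ψ.ofConv (translate χ a) = (χ * ψ).ofConv a := by
  rw [translate, apply_coeff, ← apply_smul, regular_smul_def]

theorem counit_translate (χ : DualAlg k A) (a : A) :
    Coalgebra.counit (R := k) (translate χ a) = χ.ofConv a := by
  have := apply_translate χ 1 a
  rwa [mul_one] at this

theorem translate_mul (χ ψ : DualAlg k A) (a : A) :
    translate (χ * ψ) a = translate ψ (translate χ a) :=
  dual_ext (k := k) fun θ => by rw [apply_translate, apply_translate, apply_translate, mul_assoc]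

/-- Left and right translations commute, so `translate χ` is a morphism of the regular
representation. -/
theorem translate_mem_isotypic {i : IrrClass k A} (χ : DualAlg k A) {a : A}
    (ha : a ∈ isotypic i) : translate χ a ∈ isotypic i := by
  let f : A →ₗ[DualAlg k A] A :=
    { toFun := translate χ
      map_add' := map_add _
      map_smul' := fun ψ b => coeff_actLin (isCoaction_comul k A) χ.ofConv ψ b }
  exact LinearMap.le_comap_isotypicComponent i.rep.E f ha

/-- Left multiplication by `χ` on `A_i^*` is the transpose of `translate χ` on `A_i`, and a map and
its transpose have the same trace. -/
theorem blockTrace_component (i : IrrClass k A) (χ : DualAlg k A) :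
    blockTrace i (component i χ) = LinearMap.trace k (isotypic i)
      ((translate χ).restrict fun _ ha => translate_mem_isotypic χ ha) := by
  obtain ⟨e, he⟩ := exists_block_equiv_dual i
  rw [← LinearMap.trace_transpose']
  change LinearMap.trace k (block i) (LinearMap.mulLeft k (component i χ)) = _
  rw [← LinearMap.trace_conj' _ e]
  congr 1
  ext f a
  obtain ⟨b, rfl⟩ := e.surjective f
  obtain ⟨ψ, rfl⟩ := (actIrr i).rangeRestrict_surjective b
  change e (LinearMap.mulLeft k (component i χ) (e.symm (e (component i ψ)))) a =
    e (component i ψ) _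
  rw [e.symm_apply_apply, LinearMap.mulLeft_apply, ← map_mul, he, he]
  exact (apply_translate χ ψ a).symm

end PeterWeyl

/-! ### Invariant integral, Fourier transform and inversion -/

section Integral

variable {k : Type u} [Field k] {A : Type v} [CommRing A] [HopfAlgebra k A]

open HopfAlgebra WithConv

/-- Algebra morphisms `A → A` form a group under convolution, in which inversion is composition with
the antipode; the inverse of the inverse of the identity is the identity. -/
theorem antipode_antipode (a : A) : antipode k (antipode k a) = a := by
  have h := inv_inv (toConv (AlgHom.id k A))
  exact AlgHom.congr_fun (congrArg WithConv.ofConv h) a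

/-- In the group of algebra morphisms `A → A ⊗ A` the comultiplication is the product of the two
inclusions; this is the rule `(l r)⁻¹ = r⁻¹ l⁻¹`. -/
theorem comul_antipode (a : A) : Coalgebra.comul (R := k) (antipode k a) =
    TensorProduct.map (antipode k) (antipode k)
      (TensorProduct.comm k A A (Coalgebra.comul (R := k) a)) := by
  let l : WithConv (A →ₐ[k] A ⊗[k] A) := toConv Algebra.TensorProduct.includeLeft
  let r : WithConv (A →ₐ[k] A ⊗[k] A) := toConv Algebra.TensorProduct.includeRight
  have key : ∀ (f g : A →ₐ[k] A ⊗[k] A) (b : A), (toConv f * toConv g).ofConv b =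
      LinearMap.mul' k _ (TensorProduct.map f.toLinearMap g.toLinearMap
        (Coalgebra.comul (R := k) b)) := fun f g b => rfl
  have h1 : l * r = toConv (Bialgebra.comulAlgHom k A) := by
    ext b
    refine (key _ _ b).trans ?_
    change _ = Coalgebra.comul (R := k) b
    induction Coalgebra.comul (R := k) b with
    | zero => simp
    | add s t hs ht => simp only [map_add, hs, ht]
    | tmul x y => simp
  have h2 := mul_inv_rev l r
  rw [h1] at h2
  have h3 := AlgHom.congr_fun (congrArg WithConv.ofConv h2) a
  refine h3.trans ((key _ _ a).trans ?_)
  induction Coalgebra.comul (R := k) a with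
  | zero => simp
  | add s t hs ht => simp only [map_add, hs, ht]
  | tmul x y => simp [l, r]

theorem dualStar_dualStar (χ : DualAlg k A) : dualStar (dualStar χ) = χ := by
  ext a
  exact congrArg χ.ofConv (antipode_antipode a)

theorem dualStar_mul (χ ψ : DualAlg k A) : dualStar (χ * ψ) = dualStar ψ * dualStar χ := by
  ext a
  change LinearMap.mul' k k (TensorProduct.map χ.ofConv ψ.ofConv
    (Coalgebra.comul (R := k) (antipode k a))) = LinearMap.mul' k k (TensorProduct.map
      (ψ.ofConv ∘ₗ antipode k) (χ.ofConv ∘ₗ antipode k) (Coalgebra.comul (R := k) a))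
  rw [comul_antipode]
  induction Coalgebra.comul (R := k) a with
  | zero => simp
  | add s t hs ht => simp only [map_add, hs, ht]
  | tmul x y => simp [mul_comm]

theorem dualStar_apply (χ : DualAlg k A) (a : A) :
    (dualStar χ).ofConv a = χ.ofConv (antipode k a) := rfl

theorem dualStar_smul (c : k) (χ : DualAlg k A) : dualStar (c • χ) = c • dualStar χ := rfl

theorem IsInvariantIntegral.eq {h h' : DualAlg k A} (H : IsInvariantIntegral h)
    (H' : IsInvariantIntegral h') : h = h' := by
  have h1 := H.left_invariant h'
  rw [H'.right_invariant h, H.normalized, H'.normalized, one_smul, one_smul] at h1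
  exact h1.symm

/-- The star reverses products, so it exchanges left and right invariance; uniqueness concludes. -/
theorem IsInvariantIntegral.dualStar_eq {h : DualAlg k A} (H : IsInvariantIntegral h) :
    dualStar h = h := by
  refine IsInvariantIntegral.eq ⟨?_, fun χ => ?_, fun χ => ?_⟩ H
  · rw [dualStar_apply, antipode_one, H.normalized]
  · rw [← dualStar_dualStar χ, ← dualStar_mul, H.right_invariant, dualStar_smul,
      dualStar_dualStar, dualStar_apply, antipode_one]
  · rw [← dualStar_dualStar χ, ← dualStar_mul, H.left_invariant, dualStar_smul,
      dualStar_dualStar, dualStar_apply, antipode_one]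

theorem smul_one_eq (χ : DualAlg k A) : χ • (1 : A) = χ.ofConv 1 • (1 : A) := by
  rw [regular_smul_def, actLin_apply, Bialgebra.comul_one, Algebra.TensorProduct.one_def,
    contr_tmul]

/-- Take the form `h` with `h(1) = 1` that vanishes on an invariant complement `W` of the constants.
Stability of `W` gives right invariance, hence left invariance of `h^*`, and comparing the two
values of `h * h^*` gives `h^* = h`. -/
theorem IsLinearlySemisimple.exists_isInvariantIntegral (hG : IsLinearlySemisimple k A) :
    ∃ h : DualAlg k A, IsInvariantIntegral h := by
  obtain ⟨W, hW, hc⟩ := hG A _ (isCoaction_comul k A) (k ∙ (1 : A)) <| by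
    rw [isSubrep_iff]
    intro χ x hx
    obtain ⟨c, rfl⟩ := Submodule.mem_span_singleton.1 hx
    rw [map_smul]
    refine Submodule.smul_mem _ _ (Submodule.mem_span_singleton.2 ⟨χ 1, ?_⟩)
    exact (smul_one_eq (toConv χ)).symm
  rw [isSubrep_iff] at hW
  have hA : (1 : A) ≠ 0 := fun h0 => one_ne_zero (α := k) <| by
    rw [← Bialgebra.counit_one (R := k) (A := A), h0, map_zero]
  have h1 : (1 : A) ∉ W := fun h1 => hA <|
    Submodule.disjoint_def.1 hc.disjoint _ (Submodule.mem_span_singleton_self _) h1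
  obtain ⟨f, hf1, hfW⟩ := Submodule.exists_le_ker_of_notMem h1
  let h : DualAlg k A := toConv ((f 1)⁻¹ • f)
  have hone : h.ofConv 1 = 1 := inv_mul_cancel₀ hf1
  have hzero : ∀ x ∈ W, h.ofConv x = 0 := fun x hx => by
    change (f 1)⁻¹ • f x = 0
    rw [hfW hx, smul_zero]
  have hr : ∀ χ : DualAlg k A, h * χ = χ.ofConv 1 • h := by
    intro χ
    ext a
    obtain ⟨y, hy, z, hz, rfl⟩ := Submodule.mem_sup.1
      (hc.sup_eq_top ▸ Submodule.mem_top : a ∈ (k ∙ (1 : A)) ⊔ W)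
    obtain ⟨c, rfl⟩ := Submodule.mem_span_singleton.1 hy
    change (h * χ).ofConv _ = χ.ofConv 1 * h.ofConv _
    have hz' : h.ofConv (χ • z) = 0 := hzero _ (hW χ.ofConv z hz)
    have hy' : χ • (c • (1 : A)) = c • (χ.ofConv 1 • (1 : A)) := by
      rw [← smul_one_eq]
      exact map_smul (actLin (Coalgebra.comul (R := k)) χ.ofConv) c (1 : A)
    rw [← apply_smul, smul_add, map_add, hz', hy', map_add, hzero z hz, map_smul, map_smul,
      map_smul, hone]
    simp [mul_comm]
  have hl : ∀ χ : DualAlg k A, χ * dualStar h = χ.ofConv 1 • dualStar h := by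
    intro χ
    rw [← dualStar_dualStar χ, ← dualStar_mul, hr, dualStar_smul, dualStar_dualStar,
      dualStar_apply, antipode_one]
  have heq : dualStar h = h := by
    have h1 := hl h
    rw [hr, hone, dualStar_apply, antipode_one, hone, one_smul, one_smul] at h1
    exact h1.symm
  rw [heq] at hl
  exact ⟨h, hone, hl, hr⟩

theorem IsInvariantIntegral.translate_eq {h : DualAlg k A} (H : IsInvariantIntegral h) (a : A) :
    translate h a = h.ofConv a • (1 : A) := by
  refine dual_ext (k := k) fun χ => ?_
  rw [apply_translate, H.right_invariant, map_smul]
  exact mul_comm _ _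

/-- As a convolution product, translation can be cancelled against the antipode by associativity. -/
theorem translate_eq_conv (χ : DualAlg k A) :
    toConv (translate χ) = toConv (Algebra.linearMap k A ∘ₗ χ.ofConv) * toConv LinearMap.id := by
  ext a
  change TensorProduct.lid k A (χ.ofConv.rTensor A (Coalgebra.comul (R := k) a)) =
    LinearMap.mul' k A (TensorProduct.map (Algebra.linearMap k A ∘ₗ χ.ofConv) LinearMap.id
      (Coalgebra.comul (R := k) a))
  induction Coalgebra.comul (R := k) a with
  | zero => simp
  | add s t hs ht => simp only [map_add, hs, ht]
  | tmul x y => simp [Algebra.smul_def]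

/-- `∑ χ(a₁) a₂ S(a₃) = χ(a)`. -/
theorem mul_translate_antipode (χ : DualAlg k A) (a : A) :
    LinearMap.mul' k A (TensorProduct.map (translate χ) (antipode k)
      (Coalgebra.comul (R := k) a)) = algebraMap k A (χ.ofConv a) := by
  have h : toConv (translate χ) * toConv (antipode k) =
      toConv (Algebra.linearMap k A ∘ₗ χ.ofConv) := by
    rw [translate_eq_conv, mul_assoc, LinearMap.id_mul_antipode, mul_one]
  exact LinearMap.congr_fun (congrArg WithConv.ofConv h) a

/-- `∑ h(c y₁) y₂ = ∑ h(c₁ y) S(c₂)` for an invariant integral `h`. -/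
theorem IsInvariantIntegral.translate_mulLeft {h : DualAlg k A} (H : IsInvariantIntegral h)
    (c y : A) : translate (toConv (h.ofConv ∘ₗ LinearMap.mulLeft k c)) y =
      LinearMap.mul' k A (TensorProduct.map
        (Algebra.linearMap k A ∘ₗ h.ofConv ∘ₗ LinearMap.mulRight k y) (antipode k)
        (Coalgebra.comul (R := k) c)) := by
  let P : A →ₗ[k] A :=
    { toFun := fun c => translate (toConv (h.ofConv ∘ₗ LinearMap.mulLeft k c)) y
      map_add' := fun c d => dual_ext (k := k) fun ψ => by
        rw [map_add, apply_translate, apply_translate, apply_translate]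
        have : toConv (h.ofConv ∘ₗ LinearMap.mulLeft k (c + d)) =
            toConv (h.ofConv ∘ₗ LinearMap.mulLeft k c) +
              toConv (h.ofConv ∘ₗ LinearMap.mulLeft k d) := by
          ext; simp [add_mul]
        rw [this, add_mul]
        rfl
      map_smul' := fun r c => dual_ext (k := k) fun ψ => by
        rw [map_smul, apply_translate, apply_translate]
        have : toConv (h.ofConv ∘ₗ LinearMap.mulLeft k (r • c)) =
            r • toConv (h.ofConv ∘ₗ LinearMap.mulLeft k c) := by
          ext; simp
        rw [this, smul_mul_assoc]
        rfl }
  -- Invariance at `c y` reads `∑ P(c₁) c₂ = h(c y) 1`; convolving on the right with the antipode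
  -- isolates `P`.
  have hP : toConv P * toConv LinearMap.id =
      toConv (Algebra.linearMap k A ∘ₗ h.ofConv ∘ₗ LinearMap.mulRight k y) := by
    ext c
    have h1 := H.translate_eq (c * y)
    have h2 : LinearMap.mul' k A (TensorProduct.map P LinearMap.id (Coalgebra.comul (R := k) c)) =
        translate h (c * y) := by
      change _ = TensorProduct.lid k A (h.ofConv.rTensor A (Coalgebra.comul (R := k) (c * y)))
      rw [Bialgebra.comul_mul]
      induction Coalgebra.comul (R := k) c with
      | zero => simp
      | add s t hs ht => simp only [map_add, add_mul, hs, ht]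
      | tmul x z =>
        change (TensorProduct.lid k A ((h.ofConv ∘ₗ LinearMap.mulLeft k x).rTensor A
          (Coalgebra.comul (R := k) y))) * z = _
        induction Coalgebra.comul (R := k) y with
        | zero => simp
        | add s t hs ht => simp only [map_add, add_mul, mul_add, hs, ht]
        | tmul p q => simp [mul_comm]
    refine h2.trans (h1.trans ?_)
    simp [Algebra.smul_def]
  have h3 : toConv P = toConv (Algebra.linearMap k A ∘ₗ h.ofConv ∘ₗ LinearMap.mulRight k y) *
      toConv (antipode k) := by
    rw [← hP, mul_assoc, LinearMap.id_mul_antipode, mul_one]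
  exact LinearMap.congr_fun (congrArg WithConv.ofConv h3) c

/-- This is `translate_mulLeft` at `c = S(a)`, where `Δ S(a) = ∑ S(a₂) ⊗ S(a₁)` and `S² = 1`. The
result lies in the subrepresentation generated by `a`. -/
theorem IsInvariantIntegral.translate_fourier {h : DualAlg k A} (H : IsInvariantIntegral h)
    (a y : A) : translate (fourier h a) y =
      toConv (h.ofConv ∘ₗ LinearMap.mulRight k y ∘ₗ antipode k) • a := by
  refine (H.translate_mulLeft (antipode k a) y).trans ?_
  rw [comul_antipode, regular_smul_def, actLin_apply]
  induction Coalgebra.comul (R := k) a with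
  | zero => simp
  | add s t hs ht => simp only [map_add, hs, ht]
  | tmul p q => simp [Algebra.smul_def, antipode_antipode]

/-- For `y ∈ A_j` the translate of `y` by `F(a)` lies in both `A_i` and `A_j`, so it is zero, and so
is its counit `F(a)(y)`. -/
theorem IsInvariantIntegral.component_fourier {h : DualAlg k A} (H : IsInvariantIntegral h)
    {i j : IrrClass k A} (hij : i ≠ j) {a : A} (ha : a ∈ isotypic i) :
    component j (fourier h a) = 0 := by
  rw [component_eq_zero_iff]
  intro y hy
  rw [← counit_translate]
  rw [disjoint_isotypic hij (H.translate_fourier a y ▸ smul_mem_isotypic _ ha)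
    (translate_mem_isotypic _ hy), map_zero]

theorem IsInvariantIntegral.blockTrace_fourier_mul {h : DualAlg k A} (H : IsInvariantIntegral h)
    {i : IrrClass k A} {a : A} (ha : a ∈ isotypic i) (χ : DualAlg k A) :
    blockTrace i (component i (fourier h a * χ)) = χ.ofConv a := by
  -- `Δ(a)` is written as a finite sum with left factors in `A_i`, so that each rank-one term is an
  -- endomorphism of `A_i`.
  obtain ⟨t, ht⟩ := (isSubrep_iff (ρ := Coalgebra.comul (R := k) (A := A)) (isotypic i)).2
    (fun ψ x hx => smul_mem_isotypic (toConv ψ) hx) a ha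
  obtain ⟨s, rfl⟩ := TensorProduct.exists_finset t
  rw [map_sum] at ht
  simp only [LinearMap.rTensor_tmul, Submodule.subtype_apply] at ht
  let T : isotypic i →ₗ[k] isotypic i :=
    (translate χ).restrict fun _ hb => translate_mem_isotypic χ hb
  let φ : A → isotypic i →ₗ[k] k := fun b =>
    h.ofConv ∘ₗ LinearMap.mulLeft k (antipode k b) ∘ₗ (isotypic i).subtype
  have key : ((translate (fourier h a * χ)).restrict
      fun _ hb => translate_mem_isotypic (fourier h a * χ) hb) =
      ∑ p ∈ s, (φ p.2).smulRight (T p.1) := by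
    ext y
    rw [LinearMap.coe_restrict_apply, translate_mul, H.translate_fourier, regular_smul_def,
      actLin_apply, ← ht, map_sum, map_sum, LinearMap.sum_apply, Submodule.coe_sum]
    refine Finset.sum_congr rfl fun p _ => ?_
    rw [contr_tmul, map_smul]
    rfl
  rw [blockTrace_component, key, map_sum]
  simp only [LinearMap.trace_smulRight]
  have h1 := congrArg h.ofConv (mul_translate_antipode χ a)
  rw [← ht, Algebra.algebraMap_eq_smul_one, map_smul, H.normalized, map_sum, map_sum,
    map_sum] at h1
  refine Eq.trans (Finset.sum_congr rfl fun p _ => ?_) (h1.trans (mul_one _))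
  rw [TensorProduct.map_tmul, LinearMap.mul'_apply, mul_comm]
  rfl

theorem mul_mem_tildeA {χ : DualAlg k A} (hχ : χ ∈ tildeA k A) (ψ : DualAlg k A) :
    χ * ψ ∈ tildeA k A :=
  Set.Finite.subset hχ fun i hi h => hi (by rw [map_mul, h, zero_mul])

/-- Right multiplication by `ψ ∈ A^*` on `Ã`. -/
def tildeMul (ψ : DualAlg k A) : tildeA k A →ₗ[k] tildeA k A where
  toFun χ := ⟨χ * ψ, mul_mem_tildeA χ.2 ψ⟩
  map_add' _ _ := Subtype.ext (add_mul _ _ _)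
  map_smul' _ _ := Subtype.ext (smul_mul_assoc _ _ _)

theorem IsInvariantIntegral.fourier_mem (hG : IsLinearlySemisimple k A) {h : DualAlg k A}
    (H : IsInvariantIntegral h) (a : A) : fourier h a ∈ tildeA k A := by
  have hle : ⨆ i : IrrClass k A, isotypic i ≤ (tildeA k A).comap (fourier h) :=
    iSup_le fun i b hb => Set.Finite.subset (Set.finite_singleton i) fun j hj => by
      by_contra hne
      exact hj (H.component_fourier (fun e => hne (by rw [e]; rfl)) hb)
  rw [iSup_isotypic_eq_top hG] at hle
  exact hle Submodule.mem_top

/-- The Fourier transform `A → Ã`. -/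
def fourierTilde (hG : IsLinearlySemisimple k A) {h : DualAlg k A}
    (H : IsInvariantIntegral h) : A →ₗ[k] tildeA k A :=
  (fourier h).codRestrict _ (H.fourier_mem hG)

theorem trHat_fourier_mul (hG : IsLinearlySemisimple k A) {h : DualAlg k A}
    (H : IsInvariantIntegral h) (a : A) (ψ : DualAlg k A) :
    trHat k A (tildeMul ψ (fourierTilde hG H a)) = ψ.ofConv a := by
  have hle : ⨆ i : IrrClass k A, isotypic i ≤
      LinearMap.eqLocus (trHat k A ∘ₗ tildeMul ψ ∘ₗ fourierTilde hG H) ψ.ofConv :=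
    iSup_le fun i b hb => by
      rw [LinearMap.mem_eqLocus, ← H.blockTrace_fourier_mul hb ψ]
      refine finsum_eq_single _ i fun j hj => ?_
      change blockTrace j (component j (fourier h b * ψ)) = 0
      rw [map_mul, H.component_fourier hj.symm hb, zero_mul, map_zero]
  rw [iSup_isotypic_eq_top hG] at hle
  exact hle Submodule.mem_top

theorem fourierTilde_injective (hG : IsLinearlySemisimple k A) {h : DualAlg k A}
    (H : IsInvariantIntegral h) : Function.Injective (fourierTilde hG H) := fun a b hab =>
  dual_ext (k := k) fun ψ => by
    rw [← trHat_fourier_mul hG H, ← trHat_fourier_mul hG H, hab]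

/-- On `A_i` the other components of `F` vanish, so injectivity of `F` makes `A_i → (A_i)^*`
injective, hence surjective by dimension. -/
theorem exists_fourier_component_eq (hG : IsLinearlySemisimple k A) {h : DualAlg k A}
    (H : IsInvariantIntegral h) (i : IrrClass k A) (χ : DualAlg k A) :
    ∃ a ∈ isotypic i, component i (fourier h a) = component i χ := by
  let r : isotypic i →ₗ[k] Module.Dual k (isotypic i) :=
    { toFun := fun a => (fourier h a).ofConv ∘ₗ (isotypic i).subtype
      map_add' := fun a b => by
        rw [Submodule.coe_add, map_add]
        rfl
      map_smul' := fun c a => by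
        rw [Submodule.coe_smul, map_smul]
        rfl }
  have hr : Function.Injective r := by
    rw [injective_iff_map_eq_zero]
    intro a ha
    have h0 : fourier h (a : A) = 0 := by
      refine (bijective_component hG).1 (funext fun j => ?_)
      refine Eq.trans ?_ (map_zero (component j)).symm
      by_cases hij : i = j
      · subst hij
        rw [component_eq_zero_iff]
        exact fun b hb => LinearMap.congr_fun ha ⟨b, hb⟩
      · exact H.component_fourier hij a.2
    refine Subtype.ext (fourierTilde_injective hG H (Subtype.ext ?_))
    rw [Submodule.coe_zero, map_zero]
    exact h0
  have hs := (LinearMap.injective_iff_surjective_of_finrank_eq_finrank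
    (Subspace.dual_finrank_eq (K := k) (V := isotypic i)).symm).1 hr
  obtain ⟨a, ha⟩ := hs (χ.ofConv ∘ₗ (isotypic i).subtype)
  refine ⟨a, a.2, ?_⟩
  rw [← sub_eq_zero, ← map_sub, component_eq_zero_iff]
  intro b hb
  exact sub_eq_zero.2 (LinearMap.congr_fun ha ⟨b, hb⟩)

theorem fourierTilde_bijective (hG : IsLinearlySemisimple k A) {h : DualAlg k A}
    (H : IsInvariantIntegral h) : Function.Bijective (fourierTilde hG H) := by
  classical
  refine ⟨fourierTilde_injective hG H, fun χ => ?_⟩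
  choose a ha hχ using fun i => exists_fourier_component_eq hG H i (χ : DualAlg k A)
  have hfin : {i : IrrClass k A | component i (χ : DualAlg k A) ≠ 0}.Finite := χ.2
  refine ⟨∑ i ∈ hfin.toFinset, a i, Subtype.ext ((bijective_component hG).1 (funext fun j => ?_))⟩
  change component j (fourier h _) = component j _
  rw [map_sum, map_sum]
  by_cases hj : j ∈ hfin.toFinset
  · rw [Finset.sum_eq_single_of_mem j hj fun i _ hij => H.component_fourier hij (ha i), hχ]
  · rw [Finset.sum_eq_zero fun i hi => H.component_fourier (fun e : i = j => hj (e ▸ hi)) (ha i)]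
    by_contra hne
    exact hj (hfin.mem_toFinset.2 fun e => hne e.symm)

/-- `h` is fixed by the star and `S` is multiplicative, so `h(S(a) S(b)) = h(ab)`. -/
theorem IsInvariantIntegral.dualStar_fourier {h : DualAlg k A} (H : IsInvariantIntegral h)
    (a : A) : dualStar (fourier h a) = fourier h (antipode k a) := by
  ext b
  change h.ofConv (antipode k a * antipode k b) = h.ofConv (antipode k (antipode k a) * b)
  rw [← antipode_mul_distrib, ← dualStar_apply, H.dualStar_eq, antipode_antipode]

end Integral

/-! ### Algebraically closed fields and values at points -/

section AlgClosed

variable {k : Type u} [Field k] {A : Type v} [CommRing A] [HopfAlgebra k A]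

/-- By Schur's lemma the commutant is `k`, so every `k`-linear `u` commutes with it; Jacobson
density gives a form acting as `u` on a basis. -/
theorem block_eq_top [IsAlgClosed k] (i : IrrClass k A) : block i = ⊤ := by
  classical
  rw [eq_top_iff]
  intro u _
  let b := Module.finBasis k i.rep.E
  let f : Module.End (Module.End (DualAlg k A) i.rep.E) i.rep.E :=
    { u with
      map_smul' := fun φ x => by
        obtain ⟨c, rfl⟩ := (IsSimpleModule.algebraMap_end_bijective_of_isAlgClosed
          (A := DualAlg k A) (V := i.rep.E) k).2 φ
        exact map_smul u c x }
  obtain ⟨χ, hχ⟩ := jacobson_density (R := DualAlg k A) f (Finset.univ.image b)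
  exact ⟨χ, b.ext fun l => (hχ _ (Finset.mem_image_of_mem _ (Finset.mem_univ l))).symm⟩

/-- On the matrix unit `(i, j)` the diagonal entry is `f_ii`, independent of `j`. -/
theorem trace_mulLeft_end {E : Type*} [AddCommGroup E] [Module k E] [Module.Finite k E]
    (f : Module.End k E) : LinearMap.trace k (Module.End k E) (LinearMap.mulLeft k f) =
      (Module.finrank k E : k) * LinearMap.trace k E f := by
  let b := Module.finBasis k E
  have key : ∀ i j, b.end.repr (f * b.end (i, j)) (i, j) = b.repr (f (b i)) i := fun i j => by
    have h : ∀ (x : Module.End k E), b.end.repr x (i, j) = b.repr (x (b j)) i := fun x => by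
      rw [Module.Basis.end_repr_apply, ← LinearMap.toMatrix_apply]
      rfl
    rw [h, Module.End.mul_apply, Module.Basis.end_apply_apply, if_pos rfl]
  rw [LinearMap.trace_eq_matrix_trace k b, LinearMap.trace_eq_matrix_trace k b.end, Matrix.trace,
    Matrix.trace, Fintype.sum_prod_type, Finset.mul_sum]
  simp only [Matrix.diag_apply, LinearMap.toMatrix_apply, LinearMap.mulLeft_apply, key,
    Finset.sum_const, Finset.card_univ, Fintype.card_fin, nsmul_eq_mul]

theorem blockTrace_of_block_eq_top {i : IrrClass k A} (hi : block i = ⊤) (x : block i) :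
    blockTrace i x = (Module.finrank k i.rep.E : k) *
      LinearMap.trace k i.rep.E (x : Module.End k i.rep.E) := by
  let e : block i ≃ₗ[k] Module.End k i.rep.E :=
    LinearEquiv.ofBijective (block i).val.toLinearMap
      ⟨Subtype.val_injective, fun f => ⟨⟨f, hi ▸ Algebra.mem_top⟩, rfl⟩⟩
  rw [← trace_mulLeft_end]
  change LinearMap.trace k (block i) (LinearMap.mulLeft k x) = _
  rw [← LinearMap.trace_conj' _ e]
  congr 1
  refine LinearMap.ext fun f => ?_
  obtain ⟨y, rfl⟩ := e.surjective f
  rw [LinearEquiv.conj_apply_apply, LinearEquiv.symm_apply_apply]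
  rfl

/-- The function `g ↦ Tr(u ρ_i(g))` on `Spec A`. -/
def traceFun (i : IrrClass k A) (u : Module.End k i.rep.E) : A :=
  ∑ l, coeff i.rep.ρ ((Module.finBasis k i.rep.E).coord l ∘ₗ u) (Module.finBasis k i.rep.E l)

theorem apply_traceFun (i : IrrClass k A) (u : Module.End k i.rep.E) (χ : DualAlg k A) :
    χ.ofConv (traceFun i u) = LinearMap.trace k i.rep.E (u * actIrr i χ) := by
  rw [LinearMap.trace_eq_matrix_trace k (Module.finBasis k i.rep.E), Matrix.trace, traceFun,
    map_sum]
  refine Finset.sum_congr rfl fun l _ => ?_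
  rw [apply_coeff, Matrix.diag_apply, LinearMap.toMatrix_apply]
  rfl

theorem point_traceFun (i : IrrClass k A) (u : Module.End k i.rep.E) {B : Type w} [CommRing B]
    [Algebra k B] (g : A →ₐ[k] B) : g (traceFun i u) =
      LinearMap.trace B (B ⊗[k] i.rep.E) (u.baseChange B ∘ₗ pointAct i g) := by
  rw [LinearMap.trace_eq_matrix_trace B ((Module.finBasis k i.rep.E).baseChange B), Matrix.trace,
    traceFun, map_sum]
  refine Finset.sum_congr rfl fun l _ => ?_
  rw [Matrix.diag_apply, LinearMap.toMatrix_apply, Module.Basis.baseChange_apply,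
    LinearMap.comp_apply, pointAct, LinearMap.liftBaseChange_tmul, one_smul]
  simp only [coeff, LinearMap.comp_apply, LinearEquiv.coe_coe]
  induction i.rep.ρ (Module.finBasis k i.rep.E l) with
  | zero => simp
  | add s t hs ht => simp only [map_add, Finsupp.add_apply, hs, ht]
  | tmul e a => simp [Algebra.smul_def]

theorem IsInvariantIntegral.point_eq_finsum [IsAlgClosed k] (hG : IsLinearlySemisimple k A)
    {h : DualAlg k A} (H : IsInvariantIntegral h) {B : Type w} [CommRing B] [Algebra k B]
    (g : A →ₐ[k] B) (a : A) : g a = ∑ᶠ i : IrrClass k A, (Module.finrank k i.rep.E : B) *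
      LinearMap.trace B (B ⊗[k] i.rep.E)
        ((actIrr i (fourier h a)).baseChange B ∘ₗ pointAct i g) := by
  have hzero : ∀ (i : IrrClass k A) (b : A), component i (fourier h b) = 0 →
      (Module.finrank k i.rep.E : B) * LinearMap.trace B (B ⊗[k] i.rep.E)
        ((actIrr i (fourier h b)).baseChange B ∘ₗ pointAct i g) = 0 := by
    intro i b hb
    have : actIrr i (fourier h b) = 0 := congrArg Subtype.val hb
    rw [this, LinearMap.baseChange_zero, LinearMap.zero_comp, map_zero, mul_zero]
  have hfin : ∀ b : A, (Function.support fun i : IrrClass k A =>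
      (Module.finrank k i.rep.E : B) * LinearMap.trace B (B ⊗[k] i.rep.E)
        ((actIrr i (fourier h b)).baseChange B ∘ₗ pointAct i g)).Finite := fun b =>
    Set.Finite.subset (H.fourier_mem hG b) fun i hi hb => hi (hzero i b hb)
  have ha : a ∈ ⨆ i : IrrClass k A, isotypic i := by
    rw [iSup_isotypic_eq_top hG]
    exact Submodule.mem_top
  refine Submodule.iSup_induction _ (motive := fun a => g a = ∑ᶠ i : IrrClass k A,
    (Module.finrank k i.rep.E : B) * LinearMap.trace B (B ⊗[k] i.rep.E)
      ((actIrr i (fourier h a)).baseChange B ∘ₗ pointAct i g)) ha ?_ ?_ ?_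
  · intro i b hb
    -- Inversion against all forms determines `b` as an element of `A`, to which a point with values
    -- in any `B` applies.
    have hb' : b = (Module.finrank k i.rep.E : k) • traceFun i (actIrr i (fourier h b)) := by
      refine dual_ext (k := k) fun χ => ?_
      rw [← H.blockTrace_fourier_mul hb χ, blockTrace_of_block_eq_top (block_eq_top i), map_smul,
        apply_traceFun, ← map_mul]
      rfl
    rw [finsum_eq_single _ i fun j hj => hzero j b (H.component_fourier hj.symm hb),
      ← point_traceFun]
    conv_lhs => rw [hb']
    rw [map_smul, Algebra.smul_def, map_natCast]
  · rw [map_zero]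
    refine (finsum_eq_zero_of_forall_eq_zero fun i => hzero i 0 ?_).symm
    rw [map_zero, map_zero]
  · intro x y hx hy
    rw [map_add, hx, hy, ← finsum_add_distrib (hfin x) (hfin y)]
    refine finsum_congr fun i => ?_
    rw [map_add, map_add, LinearMap.baseChange_add, LinearMap.add_comp, map_add, mul_add]

end AlgClosed

end AffineGroup

end

theorem mainTheorem2 {k : Type u} [Field k] {A : Type v} [CommRing A] [HopfAlgebra k A]
    (hG : IsLinearlySemisimple k A) :
    -- `A^* = ∏ A_i^*` with `A_i^* ⊆ End(E_i)` finite, and `A_i^* = End(E_i)` when `k` is algebraically closed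
    Function.Bijective (fun (χ : DualAlg k A) (i : IrrClass k A) => component i χ) ∧
    (∀ i : IrrClass k A, Module.Finite k i.rep.E) ∧
    (IsAlgClosed k → ∀ i : IrrClass k A, block i = ⊤) ∧
    -- the invariant integral
    ∃ wG : DualAlg k A, IsInvariantIntegral wG ∧ (∀ w, IsInvariantIntegral w → w = wG) ∧
    -- the three arrows of the diagram, and its commutativity
    ∃ (FG : A →ₗ[k] tildeA k A) (FGhat : tildeA k A →ₗ[k] A),
      (∀ a, (FG a : DualAlg k A) = fourier wG a) ∧
      (∀ (χ : tildeA k A) (ψ : DualAlg k A), ∃ h : dualStar (χ : DualAlg k A) * ψ ∈ tildeA k A,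
        ψ.ofConv (FGhat χ) = trHat k A ⟨dualStar (χ : DualAlg k A) * ψ, h⟩) ∧
      FGhat ∘ₗ FG = HopfAlgebra.antipode k ∧
      -- the inversion formula at elements of `A^*`
      (∀ (a : A) (ψ : DualAlg k A), ∃ h : (FG a : DualAlg k A) * ψ ∈ tildeA k A,
        ψ.ofConv a = trHat k A ⟨(FG a : DualAlg k A) * ψ, h⟩) ∧
      -- and, when `k` is algebraically closed, at the points of `G` with values in any commutative `k`-algebra
      (IsAlgClosed k → ∀ (B : Type w) [CommRing B] [Algebra k B] (g : A →ₐ[k] B) (a : A),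
        g a = ∑ᶠ i : IrrClass k A, (Module.finrank k i.rep.E : B) *
          LinearMap.trace B (B ⊗[k] i.rep.E)
            ((actIrr i (FG a : DualAlg k A)).baseChange B ∘ₗ pointAct i g)) := by
  obtain ⟨h, H⟩ := hG.exists_isInvariantIntegral
  -- With `S ∘ F⁻¹` as transform of `Ĝ` the triangle commutes at once. Its integral formula at
  -- `F(a)` is inversion at `S(a)`, because `F(a)^* = F(S(a))`.
  let F := LinearEquiv.ofBijective (fourierTilde hG H) (fourierTilde_bijective hG H)
  refine ⟨bijective_component hG, fun i => inferInstance, fun _ i => block_eq_top i, h, H,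
    fun w hw => hw.eq H, fourierTilde hG H, HopfAlgebra.antipode k ∘ₗ F.symm.toLinearMap,
    fun _ => rfl, fun χ ψ => ?_, ?_, fun a ψ => ⟨mul_mem_tildeA (fourierTilde hG H a).2 ψ,
      (trHat_fourier_mul hG H a ψ).symm⟩, fun _ B _ _ g a => H.point_eq_finsum hG g a⟩
  · obtain ⟨a, rfl⟩ := F.surjective χ
    have hmem : dualStar (F a : DualAlg k A) = fourierTilde hG H (HopfAlgebra.antipode k a) :=
      H.dualStar_fourier a
    refine ⟨hmem ▸ mul_mem_tildeA (Subtype.property _) ψ, ?_⟩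
    rw [LinearMap.comp_apply, LinearEquiv.coe_coe, F.symm_apply_apply,
      ← trHat_fourier_mul hG H]
    exact congrArg (trHat k A) (Subtype.ext (congrArg (· * ψ) hmem.symm))
  · refine LinearMap.ext fun a => ?_
    exact congrArg (HopfAlgebra.antipode k) (F.symm_apply_apply a)
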